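/- Let $n \ge 1$, let $p \in (0,1)$, and let $X_1, \dots, X_n$ be independent random variables with $\mathbb{P}(X_i = 1) = p$ and $\mathbb{P}(X_i = -1) = 1-p$ for every $i$. For a real random variable $Y$ put $M(Y) = \sup_{x \in \mathbb{R}} \mathbb{P}(Y = x)$, and for $a = (a_1, \dots, a_n)$ put $a \cdot X = \sum_{i=1}^n a_i X_i$. Then $$ \sup_{a \in (\mathbb{R} \setminus \{0\})^n} M(a \cdot X) \le \frac{1}{\sqrt{1 + 2np(1-p)}}. $$ -/

import Mathlib

open MeasureTheory ProbabilityTheory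
open scoped ENNReal

/-- The concentration `M(Y) = sup_{x ∈ ℝ} ℙ(Y = x)` of a real random variable `Y` under `P`.
It takes values in `[0, ∞]`, so the supremum is a genuine least upper bound. -/
noncomputable def maxPointProb {Ω : Type*} [MeasurableSpace Ω] (P : Measure Ω) (Y : Ω → ℝ) :
    ℝ≥0∞ :=
  ⨆ x : ℝ, P {ω | Y ω = x}

/-- `Y` is a real random variable with the Rademacher distribution with parameter `p`:
it takes the value `1` with probability `p` and the value `-1` with probability `1 - p`. -/
structure IsRademacher {Ω : Type*} [MeasurableSpace Ω] (P : Measure Ω) (p : ℝ) (Y : Ω → ℝ) :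
    Prop where
  measurable : Measurable Y
  prob_one : P {ω | Y ω = 1} = ENNReal.ofReal p
  prob_neg_one : P {ω | Y ω = -1} = ENNReal.ofReal (1 - p)

/-!
The proof is Fourier-analytic. A `ℚ`-linear functional on `ℝ` that vanishes at none of the
coefficients `aᵢ` turns the event `∑ aᵢ Xᵢ = x` into an event `∑ bᵢ Xᵢ = m` with nonzero integers
`bᵢ` (`exists_int_measure_sum_eq_le`). Inversion on the circle bounds the probability of the latter
by the mean over `[0, 2π]` of the modulus of the characteristic function
(`measureReal_singleton_le_integral_norm_charFun`), which by independence is a product. With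
`c = p (1 - p)`, each factor satisfies
`|φ(bᵢ t)|² = 1 - 2 c (1 - cos (2 bᵢ t)) ≤ exp (-2 c (1 - cos (2 bᵢ t)))`
(`IsRademacher.norm_charFun_le`).

By convexity of the exponential, the product of the `n` bounds is at most the mean over `i` of
`exp (-n c (1 - cos (2 bᵢ t)))`, and the mean of this over a period does not depend on `bᵢ ≠ 0`
(`integral_prod_exp_le`). It remains to bound `g s = ∫ exp (-s (1 - cos t)) dt` over a period by
`2π / √(1 + 2 s)` at `s = n c`. An integration by parts gives `(1 + 2 s) g' + g ≤ 0`
(`integral_exp_le_mul_integral_deriv`), so `g² (1 + 2 s)` is antitone on `[0, ∞)`, with value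
`(2π)²` at `0` (`integral_exp_neg_mul_one_sub_cos_le`).
-/

/-! ### An integral bound for products of exponentials of cosines -/

/-- The differential inequality `g ≤ -(1 + 2 s) g'` for `g s = ∫ exp (-s (1 - cos t)) dt`.
Integrating the derivative of `sin t * exp (-s (1 - cos t))` over a period shows that the two sides
differ by exactly `∫ s (1 - cos t)² exp (-s (1 - cos t)) dt ≥ 0`. -/
theorem integral_exp_le_mul_integral_deriv {s : ℝ} (hs : 0 ≤ s) :
    (∫ t in (0 : ℝ)..2 * Real.pi, Real.exp (-(s * (1 - Real.cos t))))
      ≤ (1 + 2 * s) *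
        ∫ t in (0 : ℝ)..2 * Real.pi, (1 - Real.cos t) * Real.exp (-(s * (1 - Real.cos t))) := by
  have hparts : (∫ t in (0 : ℝ)..2 * Real.pi,
      (Real.cos t - s * Real.sin t ^ 2) * Real.exp (-(s * (1 - Real.cos t)))) = 0 := by
    have hd : ∀ t ∈ Set.uIcc (0 : ℝ) (2 * Real.pi),
        HasDerivAt (fun t => Real.sin t * Real.exp (-(s * (1 - Real.cos t))))
          ((Real.cos t - s * Real.sin t ^ 2) * Real.exp (-(s * (1 - Real.cos t)))) t := by
      intro t _
      have h1 := (((Real.hasDerivAt_cos t).const_sub 1).const_mul s).neg.exp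
      refine ((Real.hasDerivAt_sin t).mul h1).congr_deriv ?_
      simp only [Pi.neg_apply]
      ring
    rw [intervalIntegral.integral_eq_sub_of_hasDerivAt hd
      (Continuous.intervalIntegrable (by fun_prop) _ _)]
    simp
  have hsq : 0 ≤ ∫ t in (0 : ℝ)..2 * Real.pi,
      s * (1 - Real.cos t) ^ 2 * Real.exp (-(s * (1 - Real.cos t))) :=
    intervalIntegral.integral_nonneg Real.two_pi_pos.le fun t _ => by positivity
  have hsum : (∫ t in (0 : ℝ)..2 * Real.pi, Real.exp (-(s * (1 - Real.cos t)))) =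
      (1 + 2 * s) * (∫ t in (0 : ℝ)..2 * Real.pi,
          (1 - Real.cos t) * Real.exp (-(s * (1 - Real.cos t)))) -
        (∫ t in (0 : ℝ)..2 * Real.pi,
          s * (1 - Real.cos t) ^ 2 * Real.exp (-(s * (1 - Real.cos t)))) +
        ∫ t in (0 : ℝ)..2 * Real.pi,
          (Real.cos t - s * Real.sin t ^ 2) * Real.exp (-(s * (1 - Real.cos t))) := by
    rw [← intervalIntegral.integral_const_mul, ← intervalIntegral.integral_sub
      (Continuous.intervalIntegrable (by fun_prop) _ _)
      (Continuous.intervalIntegrable (by fun_prop) _ _), ← intervalIntegral.integral_add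
      (Continuous.intervalIntegrable (by fun_prop) _ _)
      (Continuous.intervalIntegrable (by fun_prop) _ _)]
    refine intervalIntegral.integral_congr fun t _ => ?_
    simp only [Real.sin_sq]
    ring
  linarith

theorem hasDerivAt_integral_exp_neg_mul_one_sub_cos (s : ℝ) :
    HasDerivAt (fun s : ℝ => ∫ t in (0 : ℝ)..2 * Real.pi, Real.exp (-(s * (1 - Real.cos t))))
      (-∫ t in (0 : ℝ)..2 * Real.pi,
        (1 - Real.cos t) * Real.exp (-(s * (1 - Real.cos t)))) s := by
  rw [← intervalIntegral.integral_neg]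
  refine (intervalIntegral.hasDerivAt_integral_of_dominated_loc_of_deriv_le
    (F' := fun s t => -((1 - Real.cos t) * Real.exp (-(s * (1 - Real.cos t)))))
    (bound := fun _ => 2 * Real.exp ((|s| + 1) * 2)) (Metric.ball_mem_nhds s one_pos)
    (Filter.Eventually.of_forall fun x => Continuous.aestronglyMeasurable (by fun_prop))
    (Continuous.intervalIntegrable (by fun_prop) _ _)
    (Continuous.aestronglyMeasurable (by fun_prop))
    (Filter.Eventually.of_forall fun t _ x hx => ?_)
    (Continuous.intervalIntegrable (by fun_prop) _ _)
    (Filter.Eventually.of_forall fun t _ x _ => ?_)).2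
  · have h0 : 0 ≤ 1 - Real.cos t := by linarith [Real.cos_le_one t]
    have h2 : 1 - Real.cos t ≤ 2 := by linarith [Real.neg_one_le_cos t]
    have hx' : -x ≤ |s| + 1 := by
      rw [Metric.mem_ball, Real.dist_eq] at hx
      linarith [(abs_lt.1 hx).1, neg_abs_le s]
    rw [norm_neg, Real.norm_of_nonneg (by positivity)]
    gcongr
    calc -(x * (1 - Real.cos t)) = -x * (1 - Real.cos t) := by ring
      _ ≤ (|s| + 1) * (1 - Real.cos t) := by gcongr
      _ ≤ (|s| + 1) * 2 := by gcongr
  · have h := ((hasDerivAt_id x).mul_const (1 - Real.cos t)).neg.exp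
    refine h.congr_deriv ?_
    simp only [id, one_mul, Pi.neg_apply]
    ring

/-- In terms of the modified Bessel function, `exp (-s) * I₀ s ≤ 1 / √(1 + 2 s)`. -/
theorem integral_exp_neg_mul_one_sub_cos_le {s : ℝ} (hs : 0 ≤ s) :
    (∫ t in (0 : ℝ)..2 * Real.pi, Real.exp (-(s * (1 - Real.cos t))))
      ≤ 2 * Real.pi / Real.sqrt (1 + 2 * s) := by
  set g : ℝ → ℝ := fun s => ∫ t in (0 : ℝ)..2 * Real.pi, Real.exp (-(s * (1 - Real.cos t)))
    with hg
  have hg0 : ∀ x, 0 ≤ g x := fun x =>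
    intervalIntegral.integral_nonneg Real.two_pi_pos.le fun t _ => (Real.exp_pos _).le
  have hd := fun x => ((hasDerivAt_integral_exp_neg_mul_one_sub_cos x).pow 2).mul
    (((hasDerivAt_id x).const_mul 2).const_add 1)
  -- the derivative of `g² (1 + 2 x)` is `2 g ((1 + 2 x) g' + g) ≤ 0`
  have hanti : AntitoneOn (fun x => g x ^ 2 * (1 + 2 * x)) (Set.Ici 0) := by
    refine antitoneOn_of_hasDerivWithinAt_nonpos (convex_Ici 0)
      (fun x _ => (hd x).continuousAt.continuousWithinAt)
      (fun x _ => (hd x).hasDerivWithinAt) fun x hx => ?_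
    rw [interior_Ici] at hx
    have h := mul_le_mul_of_nonneg_left (integral_exp_le_mul_integral_deriv (le_of_lt hx)) (hg0 x)
    simp only [hg, id] at h ⊢
    norm_num
    nlinarith [h]
  have h := hanti (Set.mem_Ici.2 le_rfl) hs hs
  simp only [hg] at h
  rw [le_div_iff₀ (Real.sqrt_pos.2 (by positivity))]
  refine abs_le_of_sq_le_sq' ?_ Real.two_pi_pos.le |>.2
  rw [mul_pow, Real.sq_sqrt (by positivity)]
  simpa using h

theorem integral_exp_neg_mul_one_sub_cos_int_mul (s : ℝ) {k : ℤ} (hk : k ≠ 0) :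
    (∫ t in (0 : ℝ)..2 * Real.pi, Real.exp (-(s * (1 - Real.cos (k * t)))))
      = ∫ t in (0 : ℝ)..2 * Real.pi, Real.exp (-(s * (1 - Real.cos t))) := by
  have hk' : (k : ℝ) ≠ 0 := Int.cast_ne_zero.2 hk
  have hper : Function.Periodic (fun t => Real.exp (-(s * (1 - Real.cos t)))) (2 * Real.pi) :=
    fun t => by simp only [Real.cos_add_two_pi]
  have h := hper.intervalIntegral_add_zsmul_eq k 0 fun _ _ =>
    Continuous.intervalIntegrable (by fun_prop) _ _
  rw [intervalIntegral.integral_comp_mul_left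
    (fun t => Real.exp (-(s * (1 - Real.cos t)))) hk', mul_zero]
  simp only [zero_add, zsmul_eq_mul, smul_eq_mul] at h ⊢
  rw [h]
  field_simp

/-- Convexity of `exp` replaces the product over `i` by the mean of the functions
`exp (-N c (1 - cos (b i * t)))`, with `N` the number of factors; these all have the same integral
over a period, whatever the nonzero frequency `b i` is. -/
theorem integral_prod_exp_le {ι : Type*} [Fintype ι] [Nonempty ι] {c : ℝ} (hc : 0 ≤ c)
    {b : ι → ℤ} (hb : ∀ i, b i ≠ 0) :
    (∫ t in (0 : ℝ)..2 * Real.pi, ∏ i, Real.exp (-(c * (1 - Real.cos (b i * t)))))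
      ≤ 2 * Real.pi / Real.sqrt (1 + 2 * (Fintype.card ι * c)) := by
  set N : ℝ := (Fintype.card ι : ℝ) with hN
  have hN0 : 0 < N := by simp [hN, Fintype.card_pos]
  have hpt : ∀ t : ℝ, ∏ i, Real.exp (-(c * (1 - Real.cos (b i * t)))) ≤
      ∑ i, N⁻¹ * Real.exp (-(N * c * (1 - Real.cos (b i * t)))) := fun t => by
    have h := convexOn_exp.map_sum_le (t := Finset.univ) (w := fun _ : ι => N⁻¹)
      (p := fun i => -(N * c * (1 - Real.cos (b i * t)))) (fun _ _ => by positivity)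
      (by rw [Finset.sum_const, Finset.card_univ, nsmul_eq_mul, ← hN, mul_inv_cancel₀ hN0.ne'])
      fun _ _ => Set.mem_univ _
    rw [← Real.exp_sum]
    refine le_of_eq_of_le (congrArg _ (Finset.sum_congr rfl fun i _ => ?_)) h
    rw [smul_eq_mul]
    field_simp
  calc _ ≤ ∫ t in (0 : ℝ)..2 * Real.pi,
        ∑ i, N⁻¹ * Real.exp (-(N * c * (1 - Real.cos (b i * t)))) :=
        intervalIntegral.integral_mono_on Real.two_pi_pos.le
          (Continuous.intervalIntegrable (by fun_prop) _ _)
          (Continuous.intervalIntegrable (by fun_prop) _ _) fun t _ => hpt t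
    _ = ∑ i : ι, N⁻¹ * ∫ t in (0 : ℝ)..2 * Real.pi, Real.exp (-(N * c * (1 - Real.cos t))) := by
        rw [intervalIntegral.integral_finsetSum fun i _ =>
          Continuous.intervalIntegrable (by fun_prop) _ _]
        simp only [intervalIntegral.integral_const_mul,
          integral_exp_neg_mul_one_sub_cos_int_mul _ (hb _)]
    _ = ∫ t in (0 : ℝ)..2 * Real.pi, Real.exp (-(N * c * (1 - Real.cos t))) := by
        rw [Finset.sum_const, Finset.card_univ, nsmul_eq_mul, ← hN, mul_inv_cancel_left₀ hN0.ne']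
    _ ≤ _ := integral_exp_neg_mul_one_sub_cos_le (by positivity)

/-! ### Fourier inversion for integer-valued laws -/

theorem integral_cexp_int_mul_I (k : ℤ) :
    (∫ t in (0 : ℝ)..2 * Real.pi, Complex.exp (t * k * Complex.I))
      = if k = 0 then (2 * Real.pi : ℂ) else 0 := by
  split_ifs with hk
  · simp [hk]
  · have hk' : (k : ℂ) * Complex.I ≠ 0 :=
      mul_ne_zero (Int.cast_ne_zero.2 hk) Complex.I_ne_zero
    have h := integral_exp_mul_complex (a := 0) (b := 2 * Real.pi) hk'
    have h1 : Complex.exp (k * Complex.I * ((2 * Real.pi : ℝ) : ℂ)) = 1 := by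
      rw [← Complex.exp_int_mul_two_pi_mul_I k]
      congr 1
      push_cast
      ring
    rw [h1] at h
    simp only [Complex.ofReal_zero, mul_zero, Complex.exp_zero, sub_self, zero_div] at h
    rw [← h]
    refine intervalIntegral.integral_congr fun t _ => ?_
    congr 1
    ring

/-- Fourier inversion for an integer-valued law: `μ {m}` is the mean of `charFun μ t * exp (-i t m)`
over a period. -/
theorem measureReal_singleton_le_integral_norm_charFun (μ : Measure ℝ) [IsProbabilityMeasure μ]
    (hμ : ∀ᵐ x : ℝ ∂μ, ∃ k : ℤ, x = k) (m : ℤ) :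
    2 * Real.pi * μ.real {(m : ℝ)} ≤ ∫ t in (0 : ℝ)..2 * Real.pi, ‖charFun μ t‖ := by
  have hinv : (∫ t in (0 : ℝ)..2 * Real.pi,
      charFun μ t * Complex.exp (-(t * m * Complex.I))) =
        ((2 * Real.pi * μ.real {(m : ℝ)} : ℝ) : ℂ) := by
    have hinner : ∀ᵐ x : ℝ ∂μ, (∫ t in (0 : ℝ)..2 * Real.pi, Complex.exp (t * (x - m) * Complex.I))
        = ({(m : ℝ)} : Set ℝ).indicator (fun _ => (2 * Real.pi : ℂ)) x := by
      filter_upwards [hμ] with x ⟨k, hk⟩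
      have h := integral_cexp_int_mul_I (k - m)
      simp only [hk, Int.cast_sub, Complex.ofReal_intCast, Set.indicator_apply,
        Set.mem_singleton_iff, Int.cast_inj, sub_eq_zero] at h ⊢
      exact h
    calc (∫ t in (0 : ℝ)..2 * Real.pi, charFun μ t * Complex.exp (-(t * m * Complex.I)))
        = ∫ t in (0 : ℝ)..2 * Real.pi, ∫ x, Complex.exp (t * (x - m) * Complex.I) ∂μ := by
          refine intervalIntegral.integral_congr fun t _ => ?_
          simp only [charFun_apply_real]
          rw [← integral_mul_const]
          refine integral_congr_ae (Filter.Eventually.of_forall fun x => ?_)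
          simp only [← Complex.exp_add]
          congr 1
          ring
      _ = ∫ x : ℝ, (∫ t in (0 : ℝ)..2 * Real.pi, Complex.exp (t * (x - m) * Complex.I)) ∂μ := by
          simp only [intervalIntegral.integral_of_le Real.two_pi_pos.le]
          refine integral_integral_swap ?_
          refine Integrable.of_bound (Continuous.aestronglyMeasurable ?_) 1
            (Filter.Eventually.of_forall fun z => ?_)
          · unfold Function.uncurry
            fun_prop
          · have := Complex.norm_exp_ofReal_mul_I (z.1 * (z.2 - m))
            push_cast at this
            exact this.le
      _ = ∫ x : ℝ, ({(m : ℝ)} : Set ℝ).indicator (fun _ => (2 * Real.pi : ℂ)) x ∂μ :=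
          integral_congr_ae hinner
      _ = ((2 * Real.pi * μ.real {(m : ℝ)} : ℝ) : ℂ) := by
          rw [integral_indicator_const _ (measurableSet_singleton _), Complex.real_smul]
          push_cast
          ring
  calc 2 * Real.pi * μ.real {(m : ℝ)}
      = ‖∫ t in (0 : ℝ)..2 * Real.pi, charFun μ t * Complex.exp (-(t * m * Complex.I))‖ := by
        rw [hinv, Complex.norm_real, Real.norm_of_nonneg (by positivity)]
    _ ≤ ∫ t in (0 : ℝ)..2 * Real.pi,
          ‖charFun μ t * Complex.exp (-(t * m * Complex.I))‖ :=
        intervalIntegral.norm_integral_le_integral_norm Real.two_pi_pos.le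
    _ = _ := by
        refine intervalIntegral.integral_congr fun t _ => ?_
        have := Complex.norm_exp_ofReal_mul_I (-(t * m))
        push_cast at this
        rw [neg_mul] at this
        simp only [norm_mul, this, mul_one]

/-! ### Rademacher variables -/

theorem IsRademacher.ae_eq_one_or {Ω : Type*} [MeasurableSpace Ω] {P : Measure Ω}
    [IsProbabilityMeasure P] {p : ℝ} (hp : p ∈ Set.Icc (0 : ℝ) 1) {Y : Ω → ℝ}
    (hY : IsRademacher P p Y) : ∀ᵐ ω ∂P, Y ω = 1 ∨ Y ω = -1 := by
  have hm1 : MeasurableSet {ω | Y ω = 1} := hY.measurable (measurableSet_singleton 1)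
  have hm2 : MeasurableSet {ω | Y ω = -1} := hY.measurable (measurableSet_singleton (-1))
  have hdisj : Disjoint {ω | Y ω = 1} {ω | Y ω = -1} :=
    Set.disjoint_left.2 fun ω (h1 : Y ω = 1) (h2 : Y ω = -1) => by linarith
  have h : P ({ω | Y ω = 1} ∪ {ω | Y ω = -1}) = 1 := by
    rw [measure_union hdisj hm2, hY.prob_one, hY.prob_neg_one,
      ← ENNReal.ofReal_add hp.1 (by linarith [hp.2])]
    simp
  exact (prob_compl_eq_zero_iff (hm1.union hm2)).2 h

theorem IsRademacher.norm_charFun_le {Ω : Type*} [MeasurableSpace Ω] {P : Measure Ω}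
    [IsProbabilityMeasure P] {p : ℝ} (hp : p ∈ Set.Icc (0 : ℝ) 1) {Y : Ω → ℝ}
    (hY : IsRademacher P p Y) (t : ℝ) :
    ‖charFun (P.map Y) t‖ ≤ Real.exp (-(p * (1 - p) * (1 - Real.cos (2 * t)))) := by
  have hp0 := hp.1
  have hp1 : 0 ≤ 1 - p := by linarith [hp.2]
  have hval : charFun (P.map Y) t =
      p * Complex.exp (t * Complex.I) + (1 - p : ℝ) * Complex.exp ((-t : ℝ) * Complex.I) := by
    have hm1 : MeasurableSet {ω | Y ω = 1} := hY.measurable (measurableSet_singleton 1)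
    have hm2 : MeasurableSet {ω | Y ω = -1} := hY.measurable (measurableSet_singleton (-1))
    have hae : (fun ω => Complex.exp (t * Y ω * Complex.I)) =ᵐ[P] fun ω =>
        {ω | Y ω = 1}.indicator (fun _ => Complex.exp (t * Complex.I)) ω +
          {ω | Y ω = -1}.indicator (fun _ => Complex.exp ((-t : ℝ) * Complex.I)) ω := by
      filter_upwards [hY.ae_eq_one_or hp] with ω hω
      rcases hω with h | h <;> norm_num [Set.indicator_apply, h]
    rw [charFun_apply_real, integral_map hY.measurable.aemeasurable
        (Continuous.aestronglyMeasurable (by fun_prop)), integral_congr_ae hae,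
      integral_add ((integrable_const _).indicator hm1) ((integrable_const _).indicator hm2),
      integral_indicator_const _ hm1, integral_indicator_const _ hm2, measureReal_def,
      measureReal_def, hY.prob_one, hY.prob_neg_one, ENNReal.toReal_ofReal hp0,
      ENNReal.toReal_ofReal hp1, Complex.real_smul, Complex.real_smul]
  -- `|p e^{it} + (1 - p) e^{-it}|² = p² + (1 - p)² + 2 p (1 - p) cos (2 t)`
  have hsq : ‖charFun (P.map Y) t‖ ^ 2 = 1 - 2 * (p * (1 - p) * (1 - Real.cos (2 * t))) := by
    rw [hval, ← Complex.normSq_eq_norm_sq, Complex.normSq_apply]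
    simp only [Complex.add_re, Complex.add_im, Complex.re_ofReal_mul, Complex.im_ofReal_mul,
      Complex.exp_ofReal_mul_I_re, Complex.exp_ofReal_mul_I_im, Real.cos_neg, Real.sin_neg,
      Real.cos_two_mul]
    linear_combination (1 - 4 * p * (1 - p)) * Real.sin_sq_add_cos_sq t
  refine abs_le_of_sq_le_sq' ?_ (Real.exp_pos _).le |>.2
  rw [hsq, ← Real.exp_nat_mul]
  have := Real.add_one_le_exp (-(2 * (p * (1 - p) * (1 - Real.cos (2 * t)))))
  push_cast
  rw [mul_neg]
  linarith

/-! ### Reduction to integer coefficients -/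

/-- Finitely many nonzero reals have nonzero integer images under some additive map `ℝ → ℚ`: take a
`ℚ`-linear functional vanishing at none of them and clear denominators. -/
theorem exists_intCast_addMonoidHom {ι : Type*} [Finite ι] (a : ι → ℝ) (ha : ∀ i, a i ≠ 0) :
    ∃ (F : ℝ →+ ℚ) (b : ι → ℤ), ∀ i, b i ≠ 0 ∧ F (a i) = b i := by
  obtain ⟨f, hf⟩ := Module.exists_dual_forall_apply_ne_zero (K := ℚ) a ha
  obtain ⟨⟨N, hN⟩, h⟩ := IsLocalization.exist_integer_multiples_of_finite
    (nonZeroDivisors ℤ) fun i => f (a i)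
  choose b hb using h
  have hN0 : (N : ℚ) ≠ 0 := Int.cast_ne_zero.2 (nonZeroDivisors.ne_zero hN)
  have hb' : ∀ i, (b i : ℚ) = N * f (a i) := fun i => by
    simpa [Algebra.smul_def] using hb i
  refine ⟨(AddMonoidHom.mulLeft (N : ℚ)).comp f.toAddMonoidHom, b, fun i => ⟨fun h0 => ?_, ?_⟩⟩
  · have := hb' i
    rw [h0, Int.cast_zero] at this
    exact mul_ne_zero hN0 (hf i) this.symm
  · simp [hb']

section
variable {Ω : Type*} [MeasurableSpace Ω] {P : Measure Ω} [IsProbabilityMeasure P]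
  {ι : Type*} [Fintype ι] {p : ℝ} {X : ι → Ω → ℝ}

theorem ae_forall_exists_intCast (hp : p ∈ Set.Icc (0 : ℝ) 1)
    (hX : ∀ i, IsRademacher P p (X i)) : ∀ᵐ ω ∂P, ∃ e : ι → ℤ, ∀ i, X i ω = e i := by
  filter_upwards [ae_all_iff.2 fun i => (hX i).ae_eq_one_or hp] with ω hω
  have h : ∀ i, ∃ e : ℤ, X i ω = e := fun i =>
    (hω i).elim (fun h => ⟨1, by simp [h]⟩) fun h => ⟨-1, by simp [h]⟩
  exact ⟨fun i => (h i).choose, fun i => (h i).choose_spec⟩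

/-- Real coefficients can be replaced by nonzero integer ones without decreasing the point
probability: an additive map carries the equation `∑ aᵢ Xᵢ = x` to one with integer coefficients. -/
theorem exists_int_measure_sum_eq_le (hp : p ∈ Set.Icc (0 : ℝ) 1)
    (hX : ∀ i, IsRademacher P p (X i)) {a : ι → ℝ} (ha : ∀ i, a i ≠ 0) (x : ℝ) :
    ∃ (b : ι → ℤ) (m : ℤ), (∀ i, b i ≠ 0) ∧
      P {ω | ∑ i, a i * X i ω = x} ≤ P {ω | ∑ i, (b i : ℝ) * X i ω = m} := by
  obtain ⟨F, b, hF⟩ := exists_intCast_addMonoidHom a ha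
  -- `F x` is an integer wherever the event on the left occurs, so the floor is harmless
  refine ⟨b, ⌊F x⌋, fun i => (hF i).1, measure_mono_ae ?_⟩
  filter_upwards [ae_forall_exists_intCast hp hX] with ω ⟨e, he⟩ (hx : ∑ i, a i * X i ω = x)
  change ∑ i, (b i : ℝ) * X i ω = (⌊F x⌋ : ℝ)
  have hFx : F x = ((∑ i, b i * e i : ℤ) : ℚ) := by
    rw [← hx, map_sum]
    push_cast
    refine Finset.sum_congr rfl fun i _ => ?_
    rw [he, mul_comm, ← zsmul_eq_mul, map_zsmul, (hF i).2, zsmul_eq_mul, mul_comm]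
  rw [hFx, Int.floor_intCast]
  push_cast
  simp only [he]

/-! ### The bound for integer coefficients -/

theorem measureReal_int_sum_eq_le [Nonempty ι] (hp : p ∈ Set.Icc (0 : ℝ) 1)
    (hindep : iIndepFun X P) (hX : ∀ i, IsRademacher P p (X i))
    {b : ι → ℤ} (hb : ∀ i, b i ≠ 0) (m : ℤ) :
    P.real {ω | ∑ i, (b i : ℝ) * X i ω = m}
      ≤ 1 / Real.sqrt (1 + 2 * (Fintype.card ι * (p * (1 - p)))) := by
  have hp0 : 0 ≤ p * (1 - p) := mul_nonneg hp.1 (by linarith [hp.2])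
  have hXm := fun i => (hX i).measurable
  have hYm : ∀ i, Measurable fun ω => (b i : ℝ) * X i ω := fun i => (hXm i).const_mul _
  have hSm : Measurable fun ω => ∑ i, (b i : ℝ) * X i ω :=
    Finset.measurable_fun_sum _ fun i _ => hYm i
  set μ := P.map fun ω => ∑ i, (b i : ℝ) * X i ω with hμ
  have : IsProbabilityMeasure μ := Measure.isProbabilityMeasure_map hSm.aemeasurable
  have hint : ∀ᵐ y : ℝ ∂μ, ∃ k : ℤ, y = k := by
    have hcount : {y : ℝ | ∃ k : ℤ, y = k}.Countable :=
      (Set.countable_range (Int.cast : ℤ → ℝ)).mono (by rintro y ⟨k, rfl⟩; exact ⟨k, rfl⟩)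
    rw [hμ, ae_map_iff hSm.aemeasurable hcount.measurableSet]
    filter_upwards [ae_forall_exists_intCast hp hX] with ω ⟨e, he⟩
    exact ⟨∑ i, b i * e i, by push_cast; simp only [he]⟩
  have hchar : ∀ t, charFun μ t = ∏ i, charFun (P.map (X i)) (b i * t) := fun t => by
    have hYindep : iIndepFun (fun i ω => (b i : ℝ) * X i ω) P :=
      hindep.comp (fun i y => (b i : ℝ) * y) fun i => measurable_const_mul _
    rw [hμ, hYindep.charFun_map_fun_sum_eq_prod fun i => (hYm i).aemeasurable, Finset.prod_apply]
    exact Finset.prod_congr rfl fun i _ => charFun_map_mul_comp (hXm i).aemeasurable _ _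
  have hle : ∀ t, ‖charFun μ t‖ ≤
      ∏ i, Real.exp (-(p * (1 - p) * (1 - Real.cos ((2 * b i : ℤ) * t)))) := fun t => by
    rw [hchar, norm_prod]
    refine Finset.prod_le_prod (fun _ _ => norm_nonneg _) fun i _ => ?_
    have := (hX i).norm_charFun_le hp (b i * t)
    -- the factor `2` is moved into the integer frequency `2 * b i`
    rwa [← mul_assoc, ← Int.cast_ofNat, ← Int.cast_mul] at this
  have hmain : 2 * Real.pi * μ.real {(m : ℝ)} ≤
      2 * Real.pi / Real.sqrt (1 + 2 * (Fintype.card ι * (p * (1 - p)))) :=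
    calc 2 * Real.pi * μ.real {(m : ℝ)} ≤ ∫ t in (0 : ℝ)..2 * Real.pi, ‖charFun μ t‖ :=
          measureReal_singleton_le_integral_norm_charFun μ hint m
      _ ≤ ∫ t in (0 : ℝ)..2 * Real.pi,
            ∏ i, Real.exp (-(p * (1 - p) * (1 - Real.cos ((2 * b i : ℤ) * t)))) :=
          intervalIntegral.integral_mono_on Real.two_pi_pos.le
            (continuous_charFun.norm.intervalIntegrable _ _)
            (Continuous.intervalIntegrable (by fun_prop) _ _) fun t _ => hle t
      _ ≤ _ := integral_prod_exp_le hp0 fun i => mul_ne_zero two_ne_zero (hb i)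
  rw [← mul_one_div] at hmain
  rw [hμ, map_measureReal_apply hSm (measurableSet_singleton _)] at hmain
  exact le_of_mul_le_mul_left hmain Real.two_pi_pos

end

theorem mainTheorem8 {Ω : Type*} [MeasurableSpace Ω] (P : Measure Ω) [IsProbabilityMeasure P]
    (n : ℕ) (hn : 1 ≤ n) (p : ℝ) (hp : p ∈ Set.Ioo (0 : ℝ) 1)
    (X : Fin n → Ω → ℝ) (hindep : iIndepFun X P) (hX : ∀ i, IsRademacher P p (X i)) :
    (⨆ a : {a : Fin n → ℝ // ∀ i, a i ≠ 0},
        maxPointProb P (fun ω => ∑ i, a.1 i * X i ω))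
      ≤ ENNReal.ofReal (1 / Real.sqrt (1 + 2 * (n : ℝ) * p * (1 - p))) := by
  have : NeZero n := ⟨by omega⟩
  have hp' : p ∈ Set.Icc (0 : ℝ) 1 := Set.Ioo_subset_Icc_self hp
  refine iSup_le fun a => iSup_le fun x => ?_
  obtain ⟨b, m, hb, hle⟩ := exists_int_measure_sum_eq_le hp' hX a.2 x
  refine hle.trans ?_
  rw [← ofReal_measureReal]
  refine ENNReal.ofReal_le_ofReal ((measureReal_int_sum_eq_le hp' hindep hX hb m).trans_eq ?_)
  rw [Fintype.card_fin]
  ring_nf
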